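/- Let $R$ be a commutative Noetherian ring and let $\Phi$ be a system of ideals of $R$, that is, a non-empty set of ideals such that for all $\mathfrak a_1,\mathfrak a_2\in\Phi$ there is $\mathfrak b\in\Phi$ with $\mathfrak b\subseteq\mathfrak a_1\mathfrak a_2$. For an $R$-module $M$ put $\Gamma_\Phi(M)=\{x\in M : \mathfrak a x=0 \text{ for some } \mathfrak a\in\Phi\}$, let $H^i_\Phi$ be the $i$-th right derived functor of $\Gamma_\Phi$, and for an ideal $\mathfrak a$ let $H^i_{\mathfrak a}(M)=\varinjlim_n \operatorname{Ext}^i_R(R/\mathfrak a^n,M)$. Let $\mathcal S$ be a Serre subcategory of the category of $R$-modules (a class of modules containing $0$ and closed under submodules, quotients and extensions) that is a Melkersson subcategory with respect to every $\mathfrak a\in\Phi$, that is: for every $\mathfrak a\in\Phi$ and every $R$-module $X$ each of whose elements is annihilated by some power of $\mathfrak a$, if $(0:_X\mathfrak a)\in\mathcal S$, then $X\in\mathcal S$. Let $M$ be an arbitrary $R$-module and $t$ a non-negative integer. (1) Let $\mathfrak a\in\Phi$ and let $N$ be a finitely generated $R$-module with $\operatorname{Supp}_R N=V(\mathfrak a)$.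 If $\operatorname{Ext}^j_R(N,H^i_\Phi(M))\in\mathcal S$ for all $i<t$ and all $j<t-i$, then $H^i_{\mathfrak a}(M)\in\mathcal S$ for all $i<t$. (2) In particular, if $H^i_\Phi(M)\in\mathcal S$ for all $i<t$, then $H^i_{\mathfrak a}(M)\in\mathcal S$ for all $i<t$ and all $\mathfrak a\in\Phi$. -/

import Mathlib

open CategoryTheory

universe u

/-- A system of ideals of `R`: a non-empty set `Φ` of ideals such that for all `a₁, a₂ ∈ Φ` there
is `b ∈ Φ` with `b ⊆ a₁ a₂`. -/
structure IdealSystem (R : Type u) [CommRing R] where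
  carrier : Set (Ideal R)
  nonempty : carrier.Nonempty
  exists_le_mul : ∀ a₁ ∈ carrier, ∀ a₂ ∈ carrier, ∃ b ∈ carrier, b ≤ a₁ * a₂

namespace IdealSystem

variable {R : Type u} [CommRing R]

instance : Membership (Ideal R) (IdealSystem R) := ⟨fun Φ a => a ∈ Φ.carrier⟩

/-- `Γ_Φ(M) = {x ∈ M | a x = 0 for some a ∈ Φ}`, as a submodule of `M`. -/
def torsion (Φ : IdealSystem R) (M : Type u) [AddCommGroup M] [Module R M] : Submodule R M where
  carrier := {x | ∃ a ∈ Φ, ∀ r ∈ a, r • x = 0}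
  zero_mem' := by
    obtain ⟨a, ha⟩ := Φ.nonempty
    exact ⟨a, ha, fun r _ => smul_zero r⟩
  add_mem' := by
    rintro x y ⟨a, ha, hx⟩ ⟨b, hb, hy⟩
    obtain ⟨c, hc, hle⟩ := Φ.exists_le_mul a ha b hb
    refine ⟨c, hc, fun r hr => ?_⟩
    have h₁ : r • x = 0 := hx r (Ideal.mul_le_left (hle hr))
    have h₂ : r • y = 0 := hy r (Ideal.mul_le_right (hle hr))
    rw [smul_add, h₁, h₂, add_zero]
  smul_mem' := by
    rintro s x ⟨a, ha, hx⟩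
    refine ⟨a, ha, fun r hr => ?_⟩
    rw [smul_comm, hx r hr, smul_zero]

theorem map_mem_torsion (Φ : IdealSystem R) {M N : Type u} [AddCommGroup M] [Module R M]
    [AddCommGroup N] [Module R N] (f : M →ₗ[R] N) (x : M) (hx : x ∈ Φ.torsion M) :
    f x ∈ Φ.torsion N := by
  obtain ⟨a, ha, h⟩ := hx
  refine ⟨a, ha, fun r hr => ?_⟩
  rw [← map_smul, h r hr, map_zero]

/-- The functor `Γ_Φ` from the category of `R`-modules to itself; on morphisms it is restriction. -/
def torsionFunctor (Φ : IdealSystem R) : ModuleCat.{u} R ⥤ ModuleCat.{u} R where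
  obj M := ModuleCat.of R (Φ.torsion M)
  map f := ModuleCat.ofHom (f.hom.restrict (Φ.map_mem_torsion f.hom))

instance (Φ : IdealSystem R) : Φ.torsionFunctor.Additive where
  map_add := rfl

/-- The general local cohomology functor `H^i_Φ`, the `i`-th right derived functor of `Γ_Φ`. -/
noncomputable def localCohomology (Φ : IdealSystem R) (i : ℕ) :
    ModuleCat.{u} R ⥤ ModuleCat.{u} R :=
  Φ.torsionFunctor.rightDerived i

end IdealSystem

/-- The class `S` of `R`-modules satisfies the Melkersson condition with respect to the ideal `a`:
for every `a`-torsion module `M` (each element is killed by a power of `a`), if `(0 :_M a)` is in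
`S` then `M` is in `S`. -/
def IsMelkersson {R : Type u} [CommRing R] (S : ObjectProperty (ModuleCat.{u} R))
    (a : Ideal R) : Prop :=
  ∀ M : ModuleCat.{u} R, (∀ x : M, ∃ n : ℕ, ∀ r ∈ a ^ n, r • x = 0) →
    S (ModuleCat.of R (Submodule.torsionBySet R M (a : Set R))) → S M

/-!
Let `I` be an injective resolution of `M`. Over a Noetherian ring `Γ_Φ` preserves injective
modules, so `Γ_Φ(I)` and `Γ_a(I)` are complexes of injectives. Their cohomology modules are
`H^i_Φ(M)` and, because `Γ_a(I)` is the direct limit of the `Hom(R ⧸ a ^ n, I)`, `H^i_a(M)`. If `N`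
is finitely generated with support `V(a)`, then `N` is killed by a power of `a` and by a member of
`Φ`, hence `Hom(N, Γ_Φ(I)) = Hom(N, I) = Hom(N, Γ_a(I))`.

For a complex `K` of injectives, there is a spectral sequence
`Ext^q(N, H^p(K)) ⇒ H^{p+q}(Hom(N, K))`. For `K = Γ_Φ(I)` it shows that the cohomology of
`Hom(N, I)` is in `S` in degrees `< t`. For `K = Γ_a(I)` it then shows, by induction on `i`, that
`Hom(N, H^i_a(M))` is in `S`. Filtering finitely generated modules by quotients by primes, one
passes from `N` to `R ⧸ a`, which has the same support, and the Melkersson condition gives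
`H^i_a(M)` in `S`. Only edge statements about the spectral sequence are needed, and they follow from
the long exact sequences relating cocycles, coboundaries and cohomology.
-/

section SerreClass

universe w v

variable {R : Type v} [CommRing R] (S : ObjectProperty (ModuleCat.{w} R)) [S.IsSerreClass]
  {A B E X : Type w} [AddCommGroup A] [Module R A] [AddCommGroup B] [Module R B]
  [AddCommGroup E] [Module R E] [AddCommGroup X] [Module R X]

lemma prop_of_injective (f : A →ₗ[R] B) (hf : Function.Injective f)
    (hB : S (ModuleCat.of R B)) : S (ModuleCat.of R A) :=
  have : Mono (ModuleCat.ofHom f) := (ModuleCat.mono_iff_injective _).2 hf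
  S.prop_of_mono (ModuleCat.ofHom f) hB

lemma prop_of_surjective (f : A →ₗ[R] B) (hf : Function.Surjective f)
    (hA : S (ModuleCat.of R A)) : S (ModuleCat.of R B) :=
  have : Epi (ModuleCat.ofHom f) := (ModuleCat.epi_iff_surjective _).2 hf
  S.prop_of_epi (ModuleCat.ofHom f) hA

lemma prop_of_subsingleton [Subsingleton A] : S (ModuleCat.of R A) :=
  S.prop_of_isZero (ModuleCat.isZero_of_subsingleton _)

lemma prop_range_of_ker_le (f : E →ₗ[R] X) (δ : E →ₗ[R] A)
    (hδ : LinearMap.ker δ ≤ LinearMap.ker f) (hA : S (ModuleCat.of R A)) :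
    S (ModuleCat.of R (LinearMap.range f)) := by
  have hquot : S (ModuleCat.of R (E ⧸ LinearMap.ker δ)) :=
    prop_of_injective S ((LinearMap.ker δ).liftQ δ le_rfl)
      (LinearMap.ker_eq_bot.1 (Submodule.ker_liftQ_eq_bot _ _ _ le_rfl)) hA
  refine prop_of_surjective S ((LinearMap.ker δ).liftQ f.rangeRestrict
    (by rwa [LinearMap.ker_rangeRestrict])) ?_ hquot
  rw [← LinearMap.range_eq_top, Submodule.range_liftQ, LinearMap.range_rangeRestrict]

lemma prop_of_ker_le_range (f : E →ₗ[R] X) (g : X →ₗ[R] B)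
    (hfg : LinearMap.ker g ≤ LinearMap.range f) (hE : S (ModuleCat.of R (LinearMap.range f)))
    (hB : S (ModuleCat.of R B)) : S (ModuleCat.of R X) := by
  have hker : S (ModuleCat.of R (LinearMap.ker g)) :=
    prop_of_injective S (Submodule.inclusion hfg) (Submodule.inclusion_injective hfg) hE
  let T := ShortComplex.mk (ModuleCat.ofHom (LinearMap.ker g).subtype) (ModuleCat.ofHom g)
    (by ext x; exact x.2)
  have hT : T.Exact :=
    (ShortComplex.ShortExact.moduleCat_exact_iff_function_exact _).2 (g.exact_subtype_ker_map)
  exact S.prop_X₂_of_exact hT hker hB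

lemma prop_of_exact (f : A →ₗ[R] X) (g : X →ₗ[R] B)
    (hfg : LinearMap.ker g ≤ LinearMap.range f) (hA : S (ModuleCat.of R A))
    (hB : S (ModuleCat.of R B)) : S (ModuleCat.of R X) :=
  prop_of_ker_le_range S f g hfg
    (prop_of_surjective S f.rangeRestrict f.surjective_rangeRestrict hA) hB

lemma prop_fin_fun (hA : S (ModuleCat.of R A)) (n : ℕ) : S (ModuleCat.of R (Fin n → A)) := by
  induction n with
  | zero => exact prop_of_subsingleton S
  | succ n ih =>
    let e := Fin.consLinearEquiv R (fun _ : Fin (n + 1) => A)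
    refine prop_of_surjective S e.toLinearMap e.surjective ?_
    exact prop_of_exact S (LinearMap.inr R A (Fin n → A)) (LinearMap.fst R A (Fin n → A))
      (LinearMap.range_inr R A (Fin n → A)).ge ih hA

end SerreClass

section HomCohomology

universe w v v'

variable {R : Type v} [CommRing R] {C : Type v'} [Category.{w} C] [Abelian C] [Linear R C]

/-- The `n`-th cohomology module of the complex `Hom(N, K)`, written as the quotient of the module
of maps from `N` to the `n`-cocycles of `K` by those that lift along the differential. -/
abbrev HomCohomology (R : Type v) [CommRing R] [Linear R C] (K : CochainComplex C ℕ) (N : C)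
    (n : ℕ) : Type w :=
  (N ⟶ K.cycles n) ⧸ LinearMap.range
    (Linear.rightComp R N (K.toCycles ((ComplexShape.up ℕ).prev n) n))

/-- The object of `i`-coboundaries of a complex. -/
noncomputable abbrev coboundaries (K : CochainComplex C ℕ) (i : ℕ) : C :=
  Limits.kernel (K.homologyπ i)

variable (S : ObjectProperty (ModuleCat.{w} R)) [S.IsSerreClass] (K : CochainComplex C ℕ)

lemma isZero_coboundaries_zero : Limits.IsZero (coboundaries K 0) :=
  Limits.isZero_kernel_of_mono _

lemma shortExact_coboundaries_cycles (i : ℕ) :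
    (ShortComplex.mk (Limits.kernel.ι (K.homologyπ i)) (K.homologyπ i) (by simp)).ShortExact where
  exact := ShortComplex.exact_kernel _

/-- The differential `K.X i ⟶ K.X (i + 1)` as a map onto the coboundaries. -/
noncomputable def toCoboundaries (i : ℕ) : K.X i ⟶ coboundaries K (i + 1) :=
  Limits.kernel.lift _ (K.toCycles i (i + 1)) (by simp)

@[simp]
lemma toCoboundaries_ι (i : ℕ) :
    toCoboundaries K i ≫ Limits.kernel.ι (K.homologyπ (i + 1)) = K.toCycles i (i + 1) :=
  Limits.kernel.lift_ι _ _ _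

lemma shortExact_cycles_coboundaries (i : ℕ) :
    (ShortComplex.mk (K.iCycles i) (toCoboundaries K i)
      (by simp [← cancel_mono (Limits.kernel.ι _), ← cancel_mono (K.iCycles _)])).ShortExact where
  exact := ShortComplex.exact_of_f_is_kernel _ <|
    Limits.isKernelOfComp (Limits.kernel.ι _ ≫ K.iCycles (i + 1)) (K.d i (i + 1))
      (K.cyclesIsKernel i (i + 1) (by simp)) _ (by simp [← Category.assoc])
  epi_g := (ShortComplex.exact_iff_epi_kernel_lift
    (ShortComplex.mk (K.toCycles i (i + 1)) (K.homologyπ (i + 1)) (by simp))).1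
      (ShortComplex.exact_of_g_is_cokernel _ (K.homologyIsCokernel i (i + 1) (by simp)))

variable (N : C)

variable (R) in
/-- Composition with the projection of cocycles onto cohomology, as a map
`H^n(Hom(N, K)) → Hom(N, H^n(K))`. -/
noncomputable def homCohomologyπ (n : ℕ) : HomCohomology R K N n →ₗ[R] (N ⟶ K.homology n) :=
  Submodule.liftQ _ (Linear.rightComp R N (K.homologyπ n)) (by
    rintro _ ⟨g, rfl⟩
    simp)

variable (R) in
/-- The map `Hom(N, B^n(K)) → H^n(Hom(N, K))` induced by the inclusion of coboundaries in
cocycles. -/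
noncomputable def homCoboundariesTo (n : ℕ) : (N ⟶ coboundaries K n) →ₗ[R] HomCohomology R K N n :=
  Submodule.mkQ _ ∘ₗ Linear.rightComp R N (Limits.kernel.ι (K.homologyπ n))

lemma ker_homCohomologyπ_le (n : ℕ) :
    LinearMap.ker (homCohomologyπ R K N n) ≤ LinearMap.range (homCoboundariesTo R K N n) := by
  intro x hx
  obtain ⟨f, rfl⟩ := Submodule.mkQ_surjective _ x
  exact ⟨Limits.kernel.lift _ f hx, congrArg (Submodule.mkQ _) (Limits.kernel.lift_ι _ _ _)⟩

variable [HasExt.{w} C] [∀ i, Injective (K.X i)]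

lemma prop_ext_of_iso {X Y : C} (e : X ≅ Y) (j : ℕ)
    (h : S (ModuleCat.of R (Abelian.Ext N X j))) : S (ModuleCat.of R (Abelian.Ext N Y j)) :=
  prop_of_surjective S ((Abelian.Ext.mk₀ e.hom).postcompOfLinear R N (add_zero j))
    (fun y => ⟨y.comp (Abelian.Ext.mk₀ e.inv) (add_zero j), by simp⟩) h

lemma prop_ext_X₂ {T : ShortComplex C} (hT : T.ShortExact) (j : ℕ)
    (h₁ : S (ModuleCat.of R (Abelian.Ext N T.X₁ j)))
    (h₃ : S (ModuleCat.of R (Abelian.Ext N T.X₃ j))) :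
    S (ModuleCat.of R (Abelian.Ext N T.X₂ j)) :=
  prop_of_exact S ((Abelian.Ext.mk₀ T.f).postcompOfLinear R N (add_zero _))
    ((Abelian.Ext.mk₀ T.g).postcompOfLinear R N (add_zero _))
    (fun x hx => Abelian.Ext.covariant_sequence_exact₂ N hT x hx) h₁ h₃

lemma prop_ext_X₃_of_injective {T : ShortComplex C} (hT : T.ShortExact) [Injective T.X₂] (j : ℕ)
    (h₁ : S (ModuleCat.of R (Abelian.Ext N T.X₁ (j + 2)))) :
    S (ModuleCat.of R (Abelian.Ext N T.X₃ (j + 1))) :=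
  have := Abelian.Ext.subsingleton_of_injective N T.X₂ j
  prop_of_exact S ((Abelian.Ext.mk₀ T.g).postcompOfLinear R N (add_zero _))
    (hT.extClass.postcompOfLinear R N rfl)
    (fun x hx => Abelian.Ext.covariant_sequence_exact₃ N hT x rfl hx) (prop_of_subsingleton S) h₁

/-- Dimension shifting through `0 → Z^i → K^i → B^{i+1} → 0` turns `Ext^{j+1}(N, B^{i+1})` into
`Ext^{j+2}(N, Z^i)`, and `0 → B^i → Z^i → H^i → 0` lowers `i`. -/
lemma prop_ext_coboundaries (i j : ℕ)
    (h : ∀ p q, p < i → p + q = i + j + 1 → S (ModuleCat.of R (Abelian.Ext N (K.homology p) q))) :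
    S (ModuleCat.of R (Abelian.Ext N (coboundaries K i) (j + 1))) := by
  induction i generalizing j with
  | zero =>
    have : Injective (coboundaries K 0) := (isZero_coboundaries_zero K).injective
    have := Abelian.Ext.subsingleton_of_injective N (coboundaries K 0) j
    exact prop_of_subsingleton S
  | succ i ih =>
    have hZ : S (ModuleCat.of R (Abelian.Ext N (K.cycles i) (j + 2))) :=
      prop_ext_X₂ S N (shortExact_coboundaries_cycles K i) (j + 2)
        (ih (j + 1) fun p q hp hpq => h p q (by omega) (by omega))
        (h i (j + 2) (by omega) (by omega))
    exact prop_ext_X₃_of_injective S N (shortExact_cycles_coboundaries K i) j hZ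

lemma prop_ext_cycles (i j : ℕ)
    (h : ∀ p q, p ≤ i → p + q = i + j + 1 → S (ModuleCat.of R (Abelian.Ext N (K.homology p) q))) :
    S (ModuleCat.of R (Abelian.Ext N (K.cycles i) (j + 1))) :=
  prop_ext_X₂ S N (shortExact_coboundaries_cycles K i) (j + 1)
    (prop_ext_coboundaries S K N i j fun p q hp hpq => h p q hp.le hpq)
    (h i (j + 1) le_rfl (by omega))

lemma prop_range_homCoboundariesTo (n : ℕ)
    (h : ∀ p q, p < n → p + q = n → S (ModuleCat.of R (Abelian.Ext N (K.homology p) q))) :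
    S (ModuleCat.of R (LinearMap.range (homCoboundariesTo R K N n))) := by
  obtain _ | m := n
  · have : Subsingleton (N ⟶ coboundaries K 0) :=
      ⟨fun f g => (isZero_coboundaries_zero K).eq_of_tgt f g⟩
    exact prop_of_surjective S _ (LinearMap.surjective_rangeRestrict _) (prop_of_subsingleton S)
  · refine prop_range_of_ker_le S _ ((shortExact_cycles_coboundaries K m).extClass.postcompOfLinear
      R N rfl ∘ₗ Abelian.Ext.linearEquiv₀.symm.toLinearMap) ?_
      (prop_ext_cycles S K N m 0 fun p q hp hpq => h p q (by omega) hpq)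
    intro f hf
    obtain ⟨g, hg⟩ := Abelian.Ext.covariant_sequence_exact₃ N (shortExact_cycles_coboundaries K m)
      (Abelian.Ext.mk₀ f) rfl hf
    obtain ⟨g, rfl⟩ := Abelian.Ext.homEquiv₀.symm.surjective g
    have hgf : g ≫ toCoboundaries K m = f :=
      Abelian.Ext.homEquiv₀.symm.injective (by simpa using hg)
    refine (Submodule.Quotient.mk_eq_zero _).2 ?_
    rw [CochainComplex.prev_nat_succ]
    exact ⟨g, by simp [← hgf]⟩

/-- In the spectral sequence `Ext^q(N, H^p(K)) ⇒ H^{p+q}(Hom(N, K))`: the terms on the diagonal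
`p + q = n` control the limit. -/
theorem prop_homCohomology (n : ℕ)
    (h : ∀ p q, p + q = n → S (ModuleCat.of R (Abelian.Ext N (K.homology p) q))) :
    S (ModuleCat.of R (HomCohomology R K N n)) :=
  prop_of_ker_le_range S (homCoboundariesTo R K N n)
    (Abelian.Ext.linearEquiv₀.symm.toLinearMap ∘ₗ homCohomologyπ R K N n)
    (fun x hx => ker_homCohomologyπ_le K N n (by simpa using hx))
    (prop_range_homCoboundariesTo S K N n fun p q _ hpq => h p q hpq) (h n 0 (add_zero n))

/-- In the spectral sequence `Ext^q(N, H^p(K)) ⇒ H^{p+q}(Hom(N, K))`: the targets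
`Ext^q(N, H^p(K))`, `p + q = n + 1`, of the differentials starting at `Hom(N, H^n(K))`, together
with the limit, control `Hom(N, H^n(K))`. -/
theorem prop_ext_homology_zero (n : ℕ)
    (h : ∀ p q, p < n → p + q = n + 1 → S (ModuleCat.of R (Abelian.Ext N (K.homology p) q)))
    (hK : S (ModuleCat.of R (HomCohomology R K N n))) :
    S (ModuleCat.of R (Abelian.Ext N (K.homology n) 0)) := by
  refine prop_of_exact S (Abelian.Ext.linearEquiv₀.symm.toLinearMap ∘ₗ homCohomologyπ R K N n)
    ((shortExact_coboundaries_cycles K n).extClass.postcompOfLinear R N rfl) ?_ hK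
    (prop_ext_coboundaries S K N n 0 h)
  intro x hx
  obtain ⟨y, rfl⟩ := Abelian.Ext.covariant_sequence_exact₃ N (shortExact_coboundaries_cycles K n) x
    rfl hx
  obtain ⟨f, rfl⟩ := Abelian.Ext.homEquiv₀.symm.surjective y
  exact ⟨Submodule.Quotient.mk f, (Abelian.Ext.mk₀_comp_mk₀ f (K.homologyπ n)).symm⟩

end HomCohomology

lemma exists_smul_eq_of_injective {R : Type u} [CommRing R] {E : Type u} [AddCommGroup E]
    [Module R E] [Module.Injective R E] {I c : Ideal R} (f : I →ₗ[R] E)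
    (hf : ∀ x : I, (x : R) ∈ c → f x = 0) :
    ∃ e : E, (∀ r ∈ c, r • e = 0) ∧ ∀ x : I, f x = (x : R) • e := by
  let ι : I →ₗ[R] R ⧸ c := c.mkQ ∘ₗ I.subtype
  have hι (x : I) : ι x = 0 ↔ (x : R) ∈ c := Submodule.Quotient.mk_eq_zero c
  obtain ⟨h, hh⟩ := Module.Injective.out ((LinearMap.ker ι).liftQ ι le_rfl)
    (LinearMap.ker_eq_bot.1 (Submodule.ker_liftQ_eq_bot _ _ _ le_rfl))
    ((LinearMap.ker ι).liftQ f fun x hx => hf x ((hι x).1 hx))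
  have hmk (r : R) : r • h (Submodule.Quotient.mk 1) = h (Submodule.Quotient.mk r) := by
    rw [← map_smul, ← Submodule.Quotient.mk_smul, smul_eq_mul, mul_one]
  refine ⟨h (Submodule.Quotient.mk 1), fun r hr => ?_, fun x => ?_⟩
  · rw [hmk, (Submodule.Quotient.mk_eq_zero c).2 hr, map_zero]
  · exact (hh (Submodule.Quotient.mk x)).symm.trans (hmk x).symm

namespace IdealSystem

variable {R : Type u} [CommRing R] (Φ : IdealSystem R)

lemma exists_le_pow {a : Ideal R} (ha : a ∈ Φ) (k : ℕ) : ∃ b ∈ Φ, b ≤ a ^ k := by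
  induction k with
  | zero => exact ⟨a, ha, by simp⟩
  | succ k ih =>
    obtain ⟨b, hb, hle⟩ := ih
    obtain ⟨c, hc, hc'⟩ := Φ.exists_le_mul b hb a ha
    exact ⟨c, hc, hc'.trans (by rw [pow_succ]; exact Ideal.mul_mono_left hle)⟩

/-- The system of ideals formed by the powers of `a`; its torsion functor is `Γ_a`. -/
def powers (a : Ideal R) : IdealSystem R where
  carrier := Set.range fun n : ℕ => a ^ n
  nonempty := Set.range_nonempty _
  exists_le_mul := by
    rintro _ ⟨m, rfl⟩ _ ⟨n, rfl⟩
    exact ⟨_, ⟨m + n, rfl⟩, (pow_add a m n).le⟩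

lemma pow_mem_powers (a : Ideal R) (n : ℕ) : a ^ n ∈ powers a := ⟨n, rfl⟩

variable {M : Type u} [AddCommGroup M] [Module R M]

lemma exists_mem_smul_eq_zero_of_fg {P : Submodule R M} (hP : P.FG) (hPΦ : P ≤ Φ.torsion M) :
    ∃ b ∈ Φ, ∀ r ∈ b, ∀ x ∈ P, r • x = 0 := by
  induction P, hP using Submodule.fg_induction with
  | singleton x =>
    obtain ⟨b, hb, hx⟩ := hPΦ (Submodule.mem_span_singleton_self x)
    refine ⟨b, hb, fun r hr y hy => ?_⟩
    obtain ⟨s, rfl⟩ := Submodule.mem_span_singleton.1 hy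
    rw [smul_comm, hx r hr, smul_zero]
  | sup P Q _ _ hP hQ =>
    obtain ⟨b, hb, hx⟩ := hP (le_sup_left.trans hPΦ)
    obtain ⟨c, hc, hy⟩ := hQ (le_sup_right.trans hPΦ)
    obtain ⟨d, hd, hle⟩ := Φ.exists_le_mul b hb c hc
    refine ⟨d, hd, fun r hr z hz => ?_⟩
    obtain ⟨x, hxP, y, hyQ, rfl⟩ := Submodule.mem_sup.1 hz
    rw [smul_add, hx r (Ideal.mul_le_left (hle hr)) x hxP,
      hy r (Ideal.mul_le_right (hle hr)) y hyQ, add_zero]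

variable [IsNoetherianRing R]

/-- By Artin–Rees, `I ∩ b ^ (k + 1) ⊆ b I` for some `k`, where `b ∈ Φ` annihilates the image. -/
lemma exists_mem_forall_mem_map_eq_zero {I : Ideal R} (f : I →ₗ[R] M)
    (hf : ∀ x, f x ∈ Φ.torsion M) : ∃ c ∈ Φ, ∀ x : I, (x : R) ∈ c → f x = 0 := by
  obtain ⟨b, hb, hbf⟩ := Φ.exists_mem_smul_eq_zero_of_fg (P := LinearMap.range f)
    (by rw [LinearMap.range_eq_map]; exact (Module.Finite.fg_top).map _)
    (by rintro _ ⟨x, rfl⟩; exact hf x)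
  obtain ⟨k, hk⟩ := b.exists_pow_inf_eq_pow_smul I
  obtain ⟨c, hc, hle⟩ := Φ.exists_le_pow hb (k + 1)
  refine ⟨c, hc, fun x hx => ?_⟩
  have hxbI : (x : R) ∈ b • I := by
    have hx' : (x : R) ∈ b ^ (k + 1) • (⊤ : Ideal R) ⊓ I := ⟨by simpa using hle hx, x.2⟩
    rw [hk (k + 1) (by omega), Nat.add_sub_cancel_left, pow_one] at hx'
    exact Submodule.smul_mono le_rfl inf_le_right hx'
  have hbI : b • I ≤ (LinearMap.ker f).map I.subtype := by
    refine Submodule.smul_le.2 fun r hr z hz => ⟨r • ⟨z, hz⟩, ?_, rfl⟩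
    exact (map_smul f r _).trans (hbf r hr _ ⟨⟨z, hz⟩, rfl⟩)
  obtain ⟨y, hy, hyx⟩ := hbI hxbI
  rwa [← Subtype.ext hyx]

instance injective_torsion [Module.Injective R M] : Module.Injective R (Φ.torsion M) := by
  refine Module.Baer.injective fun I f => ?_
  obtain ⟨c, hc, hfc⟩ := Φ.exists_mem_forall_mem_map_eq_zero ((Φ.torsion M).subtype ∘ₗ f)
    fun x => (f x).2
  obtain ⟨e, he, hfe⟩ := exists_smul_eq_of_injective _ hfc
  exact ⟨LinearMap.toSpanSingleton R _ ⟨e, c, hc, he⟩, fun x hx =>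
    Subtype.ext (hfe ⟨x, hx⟩).symm⟩

instance injective_torsionFunctor_obj (E : ModuleCat.{u} R) [Injective E] :
    Injective (Φ.torsionFunctor.obj E) := by
  have : Module.Injective R E := (Module.injective_iff_injective_object R E).2 inferInstance
  exact (Module.injective_iff_injective_object R (Φ.torsion E)).1 inferInstance

end IdealSystem

section InjectiveResolution

universe w v v'

variable (R : Type v) [CommRing R] {C : Type v'} [Category.{w} C] [Abelian C] [Linear R C]
  [HasExt.{w} C] {M : C} (I : InjectiveResolution M) (N : C) (n : ℕ)

variable {N n} in
lemma extMk_eq_zero_iff_exists_prev (f : N ⟶ I.cocomplex.X n)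
    (hf : f ≫ I.cocomplex.d n (n + 1) = 0) :
    I.extMk f (n + 1) rfl hf = 0 ↔ ∃ g, g ≫ I.cocomplex.d ((ComplexShape.up ℕ).prev n) n = f := by
  obtain _ | n := n
  · refine ⟨fun h => ⟨0, ?_⟩, ?_⟩
    · rw [← I.extEquivCohomologyClass.apply_eq_iff_eq,
        InjectiveResolution.extEquivCohomologyClass_extMk,
        InjectiveResolution.extEquivCohomologyClass_zero,
        CochainComplex.HomComplex.CohomologyClass.mk_eq_zero_iff,
        CochainComplex.HomComplex.Cocycle.fromSingleMk_mem_coboundaries_iff _ _ _ _ _ (-1)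
          (by simp)] at h
      obtain ⟨g, hg⟩ := h
      rw [(I.cochainComplex.isZero_of_isStrictlyGE 0 (-1) (by simp)).eq_of_tgt g 0,
        Limits.zero_comp] at hg
      rw [← cancel_mono (I.cochainComplexXIso (0 : ℕ) 0 rfl).inv, ← hg, Limits.zero_comp,
        Limits.zero_comp]
    · rintro ⟨g, rfl⟩
      simp
  · rw [CochainComplex.prev_nat_succ]
    exact I.extMk_eq_zero_iff f (n + 2) rfl hf n rfl

/-- The class in `Ext^n(N, M)` of a map from `N` to the `n`-cocycles of an injective resolution of
`M`. -/
noncomputable def cocycleClass : (N ⟶ I.cocomplex.cycles n) →ₗ[R] Abelian.Ext N M n where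
  toFun f := I.extMk (f ≫ I.cocomplex.iCycles n) (n + 1) rfl (by simp)
  map_add' f g := by
    simp only [I.add_extMk, Preadditive.add_comp]
  map_smul' r f := by
    have h := I.mk₀_comp_extMk (f ≫ I.cocomplex.iCycles n) (n + 1) rfl (by simp) (r • 𝟙 N)
    simpa [Abelian.Ext.mk₀_smul] using h.symm

lemma cocycleClass_surjective : Function.Surjective (cocycleClass R I N n) := fun x => by
  obtain ⟨f, hf, rfl⟩ := I.extMk_surjective x (n + 1) rfl
  exact ⟨I.cocomplex.liftCycles f (n + 1) (by simp) hf, by simp [cocycleClass]⟩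

lemma ker_cocycleClass : LinearMap.ker (cocycleClass R I N n) = LinearMap.range
    (Linear.rightComp R N (I.cocomplex.toCycles ((ComplexShape.up ℕ).prev n) n)) := by
  ext f
  refine (extMk_eq_zero_iff_exists_prev I (f ≫ I.cocomplex.iCycles n) (by simp)).trans
    (exists_congr fun g => ?_)
  rw [← cancel_mono (I.cocomplex.iCycles n)]
  simp

lemma cocycleClass_comp {N' : C} (g : N' ⟶ N) (f : N ⟶ I.cocomplex.cycles n) :
    cocycleClass R I N' n (g ≫ f) =
      (Abelian.Ext.mk₀ g).comp (cocycleClass R I N n f) (zero_add n) := by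
  simp [cocycleClass, I.mk₀_comp_extMk]

/-- `Ext^n(N, M)` is the `n`-th cohomology of `Hom(N, I)`, for `I` an injective resolution of
`M`. -/
noncomputable def homCohomologyEquivExt :
    HomCohomology R I.cocomplex N n ≃ₗ[R] Abelian.Ext N M n :=
  Submodule.quotEquivOfEq _ _ (ker_cocycleClass R I N n).symm ≪≫ₗ
    (cocycleClass R I N n).quotKerEquivOfSurjective (cocycleClass_surjective R I N n)

end InjectiveResolution

namespace IdealSystem

variable {R : Type u} [CommRing R] (Φ : IdealSystem R) (K : CochainComplex (ModuleCat.{u} R) ℕ)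
  {N : ModuleCat.{u} R} {b : Ideal R}

/-- The complex `Γ_Φ(K)`. -/
abbrev torsionComplex : CochainComplex (ModuleCat.{u} R) ℕ :=
  (Φ.torsionFunctor.mapHomologicalComplex _).obj K

/-- The inclusion of `Γ_Φ(K)` in `K`. -/
def torsionComplexι : Φ.torsionComplex K ⟶ K where
  f n := ModuleCat.ofHom (Φ.torsion (K.X n)).subtype
  comm' _ _ _ := rfl

instance (n : ℕ) : Mono ((Φ.torsionComplexι K).f n) :=
  (ModuleCat.mono_iff_injective _).2 (Submodule.subtype_injective _)

instance (n : ℕ) : Mono (HomologicalComplex.cyclesMap (Φ.torsionComplexι K) n) :=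
  mono_of_mono_fac (HomologicalComplex.cyclesMap_i (Φ.torsionComplexι K) n)

lemma exists_comp_torsionComplexι_f (hb : b ∈ Φ) (hN : b ≤ Module.annihilator R N) {n : ℕ}
    (f : N ⟶ K.X n) : ∃ g, g ≫ (Φ.torsionComplexι K).f n = f :=
  ⟨ModuleCat.ofHom (LinearMap.codRestrict (Φ.torsion (K.X n)) f.hom fun x => ⟨b, hb, fun r hr => by
    rw [← map_smul, Module.mem_annihilator.1 (hN hr), map_zero]⟩), rfl⟩

lemma exists_comp_cyclesMap_torsionComplexι (hb : b ∈ Φ) (hN : b ≤ Module.annihilator R N)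
    {n : ℕ} (f : N ⟶ K.cycles n) :
    ∃ g, g ≫ HomologicalComplex.cyclesMap (Φ.torsionComplexι K) n = f := by
  obtain ⟨g, hg⟩ := Φ.exists_comp_torsionComplexι_f K hb hN (f ≫ K.iCycles n)
  refine ⟨HomologicalComplex.liftCycles _ g (n + 1) (by simp) ?_, ?_⟩
  · rw [← cancel_mono ((Φ.torsionComplexι K).f (n + 1)), Category.assoc,
      ← HomologicalComplex.Hom.comm, reassoc_of% hg]
    simp
  · rw [← cancel_mono (K.iCycles n), Category.assoc, HomologicalComplex.cyclesMap_i]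
    simpa using hg

lemma map_range_toCycles_torsionComplex (hb : b ∈ Φ) (hN : b ≤ Module.annihilator R N) (i n : ℕ) :
    (LinearMap.range (Linear.rightComp R N ((Φ.torsionComplex K).toCycles i n))).map
      (Linear.rightComp R N (HomologicalComplex.cyclesMap (Φ.torsionComplexι K) n)) =
    LinearMap.range (Linear.rightComp R N (K.toCycles i n)) := by
  have hcomm (g : N ⟶ (Φ.torsionComplex K).X i) :
      (g ≫ (Φ.torsionComplex K).toCycles i n) ≫
        HomologicalComplex.cyclesMap (Φ.torsionComplexι K) n =
      (g ≫ (Φ.torsionComplexι K).f i) ≫ K.toCycles i n := by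
    simp [← cancel_mono (K.iCycles n)]
  apply le_antisymm
  · rintro _ ⟨_, ⟨g, rfl⟩, rfl⟩
    exact ⟨g ≫ (Φ.torsionComplexι K).f i, (hcomm g).symm⟩
  · rintro _ ⟨f, rfl⟩
    obtain ⟨g, rfl⟩ := Φ.exists_comp_torsionComplexι_f K hb hN f
    exact ⟨_, ⟨g, rfl⟩, hcomm g⟩

/-- If `N` is annihilated by a member of `Φ`, then every map from `N` to `K` has its image in
`Γ_Φ(K)`, so that `Hom(N, Γ_Φ(K)) = Hom(N, K)`. -/
noncomputable def homCohomologyTorsionEquiv (hb : b ∈ Φ) (hN : b ≤ Module.annihilator R N) (n : ℕ) :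
    HomCohomology R (Φ.torsionComplex K) N n ≃ₗ[R] HomCohomology R K N n :=
  Submodule.Quotient.equiv _ _ (LinearEquiv.ofBijective
    (Linear.rightComp R N (HomologicalComplex.cyclesMap (Φ.torsionComplexι K) n))
    ⟨fun _ _ h => (cancel_mono (HomologicalComplex.cyclesMap (Φ.torsionComplexι K) n)).1 h,
      Φ.exists_comp_cyclesMap_torsionComplexι K hb hN⟩)
    (Φ.map_range_toCycles_torsionComplex K hb hN _ n)

end IdealSystem

lemma lt_of_mem_support_quotient {R : Type u} [CommRing R] {p : Ideal R} {W : Submodule R (R ⧸ p)}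
    (hW : W ≠ ⊥) {q : PrimeSpectrum R} (hq : q ∈ Module.support R ((R ⧸ p) ⧸ W)) :
    p < q.asIdeal := by
  have hle : (W.comap p.mkQ : Ideal R) ≤ q.asIdeal := fun r hr => by
    refine Module.annihilator_le_of_mem_support hq (Module.mem_annihilator.2 fun x => ?_)
    obtain ⟨x, rfl⟩ := Submodule.mkQ_surjective _ x
    obtain ⟨s, rfl⟩ := Submodule.mkQ_surjective _ x
    rw [← map_smul, ← map_smul, smul_eq_mul, mul_comm, ← smul_eq_mul, map_smul]
    exact (Submodule.Quotient.mk_eq_zero W).2 (W.smul_mem s hr)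
  refine lt_of_lt_of_le (lt_of_le_of_ne (Submodule.le_comap_mkQ p W) fun h => hW ?_) hle
  rw [← Submodule.map_comap_eq_of_surjective (Submodule.mkQ_surjective p) W, ← h,
    Submodule.mkQ_map_self]

section LinearMap

variable {R : Type u} [CommRing R] (S : ObjectProperty (ModuleCat.{u} R)) [S.IsSerreClass]
  (X : Type u) [AddCommGroup X] [Module R X] {N N₁ N₃ : Type u} [AddCommGroup N] [Module R N]
  [AddCommGroup N₁] [Module R N₁] [AddCommGroup N₃] [Module R N₃]

lemma prop_linearMap_of_surjective (f : N →ₗ[R] N₃) (hf : Function.Surjective f)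
    (h : S (ModuleCat.of R (N →ₗ[R] X))) : S (ModuleCat.of R (N₃ →ₗ[R] X)) :=
  prop_of_injective S (LinearMap.lcomp R X f) (LinearMap.lcomp_injective_of_surjective f hf) h

lemma prop_linearMap_of_exact (f : N₁ →ₗ[R] N) (g : N →ₗ[R] N₃) (hfg : Function.Exact f g)
    (hg : Function.Surjective g) (h₁ : S (ModuleCat.of R (N₁ →ₗ[R] X)))
    (h₃ : S (ModuleCat.of R (N₃ →ₗ[R] X))) : S (ModuleCat.of R (N →ₗ[R] X)) :=
  prop_of_exact S (LinearMap.lcomp R X g) (LinearMap.lcomp R X f)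
    (fun φ hφ => (LinearMap.exact_lcomp_of_exact_of_surjective X hfg hg φ).1 hφ) h₃ h₁

lemma prop_linearMap_of_finite [Module.Finite R N] (hX : S (ModuleCat.of R X)) :
    S (ModuleCat.of R (N →ₗ[R] X)) := by
  obtain ⟨n, f, hf⟩ := Module.Finite.exists_fin' R N
  exact prop_linearMap_of_surjective S X f hf
    (prop_of_injective S (LinearEquiv.piRing R X (Fin n) R).toLinearMap
      (LinearEquiv.injective _) (prop_fin_fun S hX n))

variable (N) [IsNoetherianRing R] [hN : Module.Finite R N]

lemma prop_linearMap_of_quotient_prime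
    (h : ∀ p ∈ Module.support R N, S (ModuleCat.of R ((R ⧸ p.asIdeal) →ₗ[R] X))) :
    S (ModuleCat.of R (N →ₗ[R] X)) := by
  induction hN using IsNoetherianRing.induction_on_isQuotientEquivQuotientPrime R with
  | subsingleton N => exact prop_of_subsingleton S
  | quotient N p e =>
    refine prop_linearMap_of_surjective S X e.symm.toLinearMap e.symm.surjective (h p ?_)
    rw [e.support_eq, Module.mem_support_iff_of_finite, Ideal.annihilator_quotient]
  | exact N₁ N₂ N₃ f g hf hg hfg h₁ h₃ =>
    rw [Module.support_of_exact hfg hf hg] at h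
    exact prop_linearMap_of_exact S X f g hfg hg (h₁ fun p hp => h p (.inl hp))
      (h₃ fun p hp => h p (.inr hp))

variable {N} in
lemma exists_linearMap_quotient_ne_zero {p : PrimeSpectrum R} (hp : p ∈ Module.support R N) :
    ∃ f : N →ₗ[R] R ⧸ p.asIdeal, f ≠ 0 := by
  by_contra! h
  obtain ⟨r, hr, hreg⟩ :=
    IsSMulRegular.subsingleton_linearMap_iff.1 (subsingleton_of_forall_eq 0 h)
  have hr0 : algebraMap R (R ⧸ p.asIdeal) r = 0 :=
    Ideal.Quotient.eq_zero_iff_mem.2 (Module.annihilator_le_of_mem_support hp hr)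
  exact one_ne_zero (hreg.right_eq_zero_of_smul (by rw [Algebra.smul_def, hr0, zero_mul]))

lemma prop_linearMap_quotient_prime_of_mem_support (h : S (ModuleCat.of R (N →ₗ[R] X)))
    (p : PrimeSpectrum R) (hp : p ∈ Module.support R N) :
    S (ModuleCat.of R ((R ⧸ p.asIdeal) →ₗ[R] X)) := by
  induction p using (InvImage.wf PrimeSpectrum.asIdeal
    (wellFounded_gt (α := Ideal R))).induction with
  | _ p ih =>
  obtain ⟨f, hf⟩ := exists_linearMap_quotient_ne_zero hp
  refine prop_linearMap_of_exact S X (LinearMap.range f).subtype (LinearMap.range f).mkQ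
    (LinearMap.exact_subtype_mkQ _) (Submodule.mkQ_surjective _)
    (prop_linearMap_of_surjective S X f.rangeRestrict f.surjective_rangeRestrict h)
    (prop_linearMap_of_quotient_prime S X _ fun q hq => ?_)
  have hpq := lt_of_mem_support_quotient (mt LinearMap.range_eq_bot.1 hf) hq
  exact ih q hpq (Module.mem_support_mono hpq.le hp)

variable {N} in
theorem prop_linearMap_of_support_subset (h : S (ModuleCat.of R (N →ₗ[R] X))) (N' : Type u)
    [AddCommGroup N'] [Module R N'] [Module.Finite R N']
    (hN' : Module.support R N' ⊆ Module.support R N) : S (ModuleCat.of R (N' →ₗ[R] X)) :=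
  prop_linearMap_of_quotient_prime S X N' fun p hp =>
    prop_linearMap_quotient_prime_of_mem_support S X N h p (hN' hp)

end LinearMap

section ExtFinite

variable {R : Type u} [CommRing R] (S : ObjectProperty (ModuleCat.{u} R)) [S.IsSerreClass]
  (N X : ModuleCat.{u} R)

lemma prop_ext_zero_iff :
    S (ModuleCat.of R (Abelian.Ext N X 0)) ↔ S (ModuleCat.of R (N →ₗ[R] X)) :=
  S.prop_iff_of_iso (Abelian.Ext.linearEquiv₀ ≪≫ₗ ModuleCat.homLinearEquiv).toModuleIso

lemma prop_ext_of_finite [IsNoetherianRing R] [Module.Finite R N] (hX : S X) (j : ℕ) :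
    S (ModuleCat.of R (Abelian.Ext N X j)) := by
  induction j generalizing N with
  | zero => exact (prop_ext_zero_iff S N X).2 (prop_linearMap_of_finite S X hX)
  | succ j ih =>
    obtain ⟨n, f, hf⟩ := Module.Finite.exists_fin' R N
    have hT := LinearMap.shortExact_shortComplexKer hf
    have : Module.Finite R f.shortComplexKer.X₁ :=
      inferInstanceAs (Module.Finite R (LinearMap.ker f))
    have : Projective f.shortComplexKer.X₂ :=
      (IsProjective.iff_projective (Fin n → R)).1 inferInstance
    have := Abelian.Ext.subsingleton_of_projective f.shortComplexKer.X₂ X j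
    exact prop_of_exact S (hT.extClass.precompOfLinear R X (add_comm 1 j))
      ((Abelian.Ext.mk₀ f.shortComplexKer.g).precompOfLinear R X (zero_add _))
      (fun x hx => Abelian.Ext.contravariant_sequence_exact₃ hT X x hx (add_comm 1 j))
      (ih f.shortComplexKer.X₁) (prop_of_subsingleton S)

end ExtFinite

section Melkersson

variable {R : Type u} [CommRing R]

lemma IdealSystem.exists_mem_smul_cycles_eq_zero (Φ : IdealSystem R)
    (K : CochainComplex (ModuleCat.{u} R) ℕ) (i : ℕ) (z : (Φ.torsionComplex K).cycles i) :
    ∃ b ∈ Φ, ∀ r ∈ b, r • z = 0 := by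
  obtain ⟨b, hb, hz⟩ := ((Φ.torsionComplex K).iCycles i z).2
  refine ⟨b, hb, fun r hr => (ModuleCat.mono_iff_injective
    ((Φ.torsionComplex K).iCycles i)).1 inferInstance ?_⟩
  rw [map_smul, map_zero]
  exact Subtype.ext (hz r hr)

lemma IdealSystem.exists_mem_smul_homology_eq_zero (Φ : IdealSystem R)
    (K : CochainComplex (ModuleCat.{u} R) ℕ) (i : ℕ) (x : (Φ.torsionComplex K).homology i) :
    ∃ b ∈ Φ, ∀ r ∈ b, r • x = 0 := by
  obtain ⟨z, rfl⟩ := (ModuleCat.epi_iff_surjective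
    ((Φ.torsionComplex K).homologyπ i)).1 inferInstance x
  obtain ⟨b, hb, hz⟩ := Φ.exists_mem_smul_cycles_eq_zero K i z
  exact ⟨b, hb, fun r hr => by rw [← map_smul, hz r hr, map_zero]⟩

variable (S : ObjectProperty (ModuleCat.{u} R)) [S.IsSerreClass] {a : Ideal R}

lemma prop_torsionBySet (X : Type u) [AddCommGroup X] [Module R X]
    (h : S (ModuleCat.of R ((R ⧸ a) →ₗ[R] X))) :
    S (ModuleCat.of R (Submodule.torsionBySet R X (a : Set R))) := by
  refine prop_of_surjective S (LinearMap.codRestrict _ (LinearMap.applyₗ (1 : R ⧸ a)) fun f => ?_)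
    (fun x => ?_) h
  · refine (Submodule.mem_torsionBySet_iff _ _).2 fun r => ?_
    rw [LinearMap.applyₗ_apply_apply, ← map_smul, Algebra.smul_def, mul_one,
      Ideal.Quotient.algebraMap_eq, Ideal.Quotient.eq_zero_iff_mem.2 r.2, map_zero]
  · refine ⟨Submodule.liftQ a (LinearMap.toSpanSingleton R X x) fun r hr =>
      (Submodule.mem_torsionBySet_iff _ _).1 x.2 ⟨r, hr⟩, Subtype.ext ?_⟩
    exact one_smul R (x : X)

variable {S} in
lemma IsMelkersson.prop_homology_torsionComplex (hSa : IsMelkersson S a)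
    (K : CochainComplex (ModuleCat.{u} R) ℕ) (i : ℕ)
    (h : S (ModuleCat.of R ((R ⧸ a) →ₗ[R] ((IdealSystem.powers a).torsionComplex K).homology i))) :
    S (((IdealSystem.powers a).torsionComplex K).homology i) := by
  refine hSa _ (fun x => ?_) (prop_torsionBySet S _ h)
  obtain ⟨_, ⟨n, rfl⟩, hx⟩ := (IdealSystem.powers a).exists_mem_smul_homology_eq_zero K i x
  exact ⟨n, hx⟩

variable [IsNoetherianRing R]

variable {S} in
/-- By induction on `i`: since the cohomology of `Γ_a(K)` is `a`-torsion, the Melkersson condition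
reduces the claim to `Hom(R ⧸ a, H^i(Γ_a(K)))`, hence by dévissage to `Hom(N, H^i(Γ_a(K)))`, which
is a term of the spectral sequence of `Γ_a(K)`. -/
theorem IsMelkersson.prop_homology_torsionComplex_of_homCohomology (hSa : IsMelkersson S a)
    (K : CochainComplex (ModuleCat.{u} R) ℕ) [∀ i, Injective (K.X i)] (N : ModuleCat.{u} R)
    [Module.Finite R N] (haN : PrimeSpectrum.zeroLocus a ⊆ Module.support R N) {k : ℕ}
    (hk : a ^ k ≤ Module.annihilator R N) (i : ℕ)
    (h : ∀ j ≤ i, S (ModuleCat.of R (HomCohomology R K N j))) :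
    S (((IdealSystem.powers a).torsionComplex K).homology i) := by
  induction i using Nat.strong_induction_on with
  | _ i ih =>
  let J := (IdealSystem.powers a).torsionComplex K
  have (j : ℕ) : Injective (J.X j) := IdealSystem.injective_torsionFunctor_obj _ (K.X j)
  have hJ : S (ModuleCat.of R (HomCohomology R J N i)) :=
    let e := (IdealSystem.powers a).homCohomologyTorsionEquiv K
      (IdealSystem.pow_mem_powers a k) hk i
    prop_of_injective S e.toLinearMap e.injective (h i le_rfl)
  have hExt : S (ModuleCat.of R (Abelian.Ext N (J.homology i) 0)) :=
    prop_ext_homology_zero S J N i (fun p q hp _ => prop_ext_of_finite S N (J.homology p)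
      (ih p hp fun j hj => h j (hj.trans hp.le)) q) hJ
  refine hSa.prop_homology_torsionComplex K i (prop_linearMap_of_support_subset S _
    ((prop_ext_zero_iff S N _).1 hExt) (R ⧸ a) ?_)
  rwa [Module.support_eq_zeroLocus, Ideal.annihilator_quotient]

end Melkersson

section ExtComparison

universe w v v'

variable (R : Type v) [CommRing R]

variable {R} in
lemma ker_homologyπ (K : CochainComplex (ModuleCat.{w} R) ℕ) (n : ℕ) :
    LinearMap.ker (K.homologyπ n).hom =
      LinearMap.range (K.toCycles ((ComplexShape.up ℕ).prev n) n).hom :=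
  (ShortComplex.Exact.moduleCat_range_eq_ker (ShortComplex.exact_of_g_is_cokernel
    (ShortComplex.mk (K.toCycles ((ComplexShape.up ℕ).prev n) n) (K.homologyπ n) (by simp))
    (K.homologyIsCokernel _ n rfl))).symm

variable {C : Type v'} [Category.{w} C] [Abelian C] [Linear R C]
  {N N' : C} (P : ProjectiveResolution N) (P' : ProjectiveResolution N') (M : C)
  (n : ℕ)

/-- The complex `Hom(P, M)`. -/
noncomputable abbrev homComplex : CochainComplex (ModuleCat.{w} R) ℕ :=
  P.complex.linearYonedaObj R M

/-- The inclusion of the `n`-cocycles of `Hom(P, M)` in `Hom(P_n, M)`. -/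
noncomputable def homComplexι : (homComplex R P M).cycles n →ₗ[R] (P.complex.X n ⟶ M) :=
  ((homComplex R P M).iCycles n).hom

lemma homComplexι_injective : Function.Injective (homComplexι R P M n) :=
  (ModuleCat.mono_iff_injective ((homComplex R P M).iCycles n)).1 inferInstance

lemma d_comp_homComplexι (z : (homComplex R P M).cycles n) :
    P.complex.d (n + 1) n ≫ homComplexι R P M n z = 0 :=
  ConcreteCategory.congr_hom ((homComplex R P M).iCycles_d n (n + 1)) z

lemma exists_homComplexι_eq (f : P.complex.X n ⟶ M) (hf : P.complex.d (n + 1) n ≫ f = 0) :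
    ∃ z, homComplexι R P M n z = f :=
  (ShortComplex.moduleCat_exact_iff _).1 (ShortComplex.exact_of_f_is_kernel
    (ShortComplex.mk _ _ ((homComplex R P M).iCycles_d n (n + 1)))
    ((homComplex R P M).cyclesIsKernel n (n + 1) (by simp))) f hf

lemma homComplexι_toCycles (m : ℕ) (g : P.complex.X m ⟶ M) :
    homComplexι R P M n ((homComplex R P M).toCycles m n g) = P.complex.d n m ≫ g :=
  ConcreteCategory.congr_hom ((homComplex R P M).toCycles_i m n) g

variable {P P'} (f : N' ⟶ N) (φ : ProjectiveResolution.Hom P' P f)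

variable {R f} in
/-- The map `Hom(P, M) ⟶ Hom(P', M)` induced by a map of resolutions `P' ⟶ P`. -/
noncomputable def homComplexMap : homComplex R P M ⟶ homComplex R P' M :=
  (HomologicalComplex.unopFunctor _ _).map
    ((((linearYoneda R C).obj M).rightOp.mapHomologicalComplex _).map φ.hom).op

lemma isoExt_inv_naturality [EnoughProjectives C] :
    (P.isoExt n M).inv ≫ ((Ext R C n).map f.op).app M =
      HomologicalComplex.homologyMap (homComplexMap M φ) n ≫ (P'.isoExt n M).inv := by
  let F := ((linearYoneda R C).obj M).rightOp
  have h₁ := ProjectiveResolution.isoLeftDerivedObj_hom_naturality f P' P φ.hom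
    (φ.hom_f_zero_comp_π_f_zero.trans (by simp)) F n
  have h₂ := HomologicalComplex.homologyOp_hom_naturality (homComplexMap (R := R) M φ) n
  have h₃ := (CommSq.vert_comp ⟨h₁⟩ ⟨h₂⟩).w
  exact congr(($h₃).unop)

variable (P P') [HasExt.{w} C]

variable {P M n} in
lemma extMk_eq_zero_iff_exists_next (f : P.complex.X n ⟶ M) (hf : P.complex.d (n + 1) n ≫ f = 0) :
    P.extMk f (n + 1) rfl hf = 0 ↔ ∃ g, P.complex.d n ((ComplexShape.down ℕ).next n) ≫ g = f := by
  obtain _ | n := n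
  · refine ⟨fun h => ⟨0, ?_⟩, ?_⟩
    · rw [← P.extEquivCohomologyClass.apply_eq_iff_eq,
        ProjectiveResolution.extEquivCohomologyClass_extMk,
        ProjectiveResolution.extEquivCohomologyClass_zero,
        CochainComplex.HomComplex.CohomologyClass.mk_eq_zero_iff,
        CochainComplex.HomComplex.Cocycle.toSingleMk_mem_coboundaries_iff _ _ _ _ _ 1
          (by simp)] at h
      obtain ⟨g, hg⟩ := h
      rw [(P.cochainComplex.isZero_of_isStrictlyLE 0 1 (by simp)).eq_of_src g 0,
        Limits.comp_zero] at hg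
      rw [← cancel_epi (P.cochainComplexXIso (-(0 : ℕ)) 0 rfl).hom, ← hg, Limits.comp_zero,
        Limits.comp_zero]
    · rintro ⟨g, rfl⟩
      simp
  · rw [ChainComplex.next_nat_succ]
    exact P.extMk_eq_zero_iff f (n + 2) rfl hf n rfl

/-- The class in `Ext^n(N, M)` of an `n`-cocycle of `Hom(P, M)`. -/
noncomputable def homComplexClass :
    (homComplex R P M).cycles n →ₗ[R] Abelian.Ext N M n where
  toFun z := P.extMk (homComplexι R P M n z) (n + 1) rfl (d_comp_homComplexι R P M n z)
  map_add' z w := by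
    simp only [map_add, P.add_extMk]
  map_smul' r z := by
    rw [RingHom.id_apply, Abelian.Ext.smul_eq_comp_mk₀, P.extMk_comp_mk₀]
    simp

lemma homComplexClass_surjective : Function.Surjective (homComplexClass R P M n) := fun x => by
  obtain ⟨f, hf, rfl⟩ := P.extMk_surjective x (n + 1) rfl
  obtain ⟨z, rfl⟩ := exists_homComplexι_eq R P M n f hf
  exact ⟨z, rfl⟩

lemma ker_homComplexClass : LinearMap.ker (homComplexClass R P M n) =
    LinearMap.ker ((homComplex R P M).homologyπ n).hom := by
  rw [ker_homologyπ]
  ext z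
  refine (extMk_eq_zero_iff_exists_next _ (d_comp_homComplexι R P M n z)).trans
    (exists_congr fun g => ?_)
  exact (homComplexι_toCycles R P M n _ g).symm.congr_left.trans
    (homComplexι_injective R P M n).eq_iff

/-- `Ext^n(N, M)` is the `n`-th cohomology of `Hom(P, M)`. -/
noncomputable def homologyHomComplexEquiv :
    (homComplex R P M).homology n ≃ₗ[R] Abelian.Ext N M n :=
  (((homComplex R P M).homologyπ n).hom.quotKerEquivOfSurjective
      ((ModuleCat.epi_iff_surjective _).1 inferInstance)).symm ≪≫ₗ
    Submodule.quotEquivOfEq _ _ (ker_homComplexClass R P M n).symm ≪≫ₗ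
    (homComplexClass R P M n).quotKerEquivOfSurjective (homComplexClass_surjective R P M n)

lemma homologyHomComplexEquiv_homologyπ (z : (homComplex R P M).cycles n) :
    homologyHomComplexEquiv R P M n ((homComplex R P M).homologyπ n z) =
      homComplexClass R P M n z := by
  have : (((homComplex R P M).homologyπ n).hom.quotKerEquivOfSurjective
      ((ModuleCat.epi_iff_surjective _).1 inferInstance)).symm ((homComplex R P M).homologyπ n z) =
        Submodule.Quotient.mk z :=
    (LinearEquiv.symm_apply_eq _).2 rfl
  exact congr((homComplexClass R P M n).quotKerEquivOfSurjective
    (homComplexClass_surjective R P M n)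
      (Submodule.quotEquivOfEq _ _ (ker_homComplexClass R P M n).symm $this))

variable {P P'}

lemma homComplexClass_cyclesMap (z : (homComplex R P M).cycles n) :
    homComplexClass R P' M n (HomologicalComplex.cyclesMap (homComplexMap M φ) n z) =
      (Abelian.Ext.mk₀ f).comp (homComplexClass R P M n z) (zero_add n) := by
  refine Eq.trans ?_ (P.mk₀_comp_extMk _ (n + 1) rfl (d_comp_homComplexι R P M n z) φ).symm
  change P'.extMk _ (n + 1) rfl (d_comp_homComplexι R P' M n _) = P'.extMk _ _ _ _
  congr 1
  exact ConcreteCategory.congr_hom (HomologicalComplex.cyclesMap_i (homComplexMap M φ) n) z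

lemma homologyHomComplexEquiv_homologyMap (x : (homComplex R P M).homology n) :
    homologyHomComplexEquiv R P' M n (HomologicalComplex.homologyMap (homComplexMap M φ) n x) =
      (Abelian.Ext.mk₀ f).comp (homologyHomComplexEquiv R P M n x) (zero_add n) := by
  obtain ⟨z, rfl⟩ := (ModuleCat.epi_iff_surjective ((homComplex R P M).homologyπ n)).1
    inferInstance x
  rw [homologyHomComplexEquiv_homologyπ, ← homComplexClass_cyclesMap R M n f φ,
    ← homologyHomComplexEquiv_homologyπ]
  exact congrArg (homologyHomComplexEquiv R P' M n) (ConcreteCategory.congr_hom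
    (HomologicalComplex.homologyπ_naturality (homComplexMap M φ) n) z)

variable (P P') [EnoughProjectives C]

/-- The comparison of the two definitions of `Ext`: by derived categories, and by deriving
`Hom(-, M)`. -/
noncomputable def extComparison :
    Abelian.Ext N M n ≃ₗ[R] ((Ext R C n).obj (.op N)).obj M :=
  (homologyHomComplexEquiv R P M n).symm ≪≫ₗ (P.isoExt n M).symm.toLinearEquiv

lemma extComparison_comp (x : Abelian.Ext N M n) :
    extComparison R P' M n ((Abelian.Ext.mk₀ f).comp x (zero_add n)) =
      ((Ext R C n).map f.op).app M (extComparison R P M n x) := by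
  obtain ⟨y, rfl⟩ := (homologyHomComplexEquiv R P M n).surjective x
  let φ : ProjectiveResolution.Hom P' P f :=
    ⟨ProjectiveResolution.lift f P' P,
      (ProjectiveResolution.lift_commutes_zero f P' P).trans (by simp)⟩
  rw [← homologyHomComplexEquiv_homologyMap R M n f φ, extComparison, extComparison,
    LinearEquiv.trans_apply, LinearEquiv.trans_apply, LinearEquiv.symm_apply_apply,
    LinearEquiv.symm_apply_apply]
  exact (ConcreteCategory.congr_hom (isoExt_inv_naturality R M n f φ) y).symm

end ExtComparison

section LocalCohomology

variable {R : Type u} [CommRing R]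

lemma bijective_desc {J : Type*} [Category J] {F : J ⥤ ModuleCat.{u} R}
    [Limits.PreservesColimit F (forget (ModuleCat R))] {c : Limits.Cocone F}
    (hc : Limits.IsColimit c) (s : Limits.Cocone F) (hsurj : ∀ x : s.pt, ∃ j y, s.ι.app j y = x)
    (hinj : ∀ j (y : F.obj j), s.ι.app j y = 0 → ∃ (k : J) (f : j ⟶ k), F.map f y = 0) :
    Function.Bijective (hc.desc s) := by
  have hfac (j : J) (y : F.obj j) : hc.desc s (c.ι.app j y) = s.ι.app j y :=
    ConcreteCategory.congr_hom (hc.fac s j) y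
  refine ⟨(injective_iff_map_eq_zero _).2 fun x hx => ?_, fun x => ?_⟩
  · obtain ⟨j, y, rfl⟩ := Limits.Concrete.isColimit_exists_rep F hc x
    obtain ⟨k, f, hf⟩ := hinj j y ((hfac j y).symm.trans hx)
    refine (ConcreteCategory.congr_hom (c.w f) y).symm.trans ?_
    exact (congrArg (c.ι.app k) hf).trans (map_zero _)
  · obtain ⟨j, y, rfl⟩ := hsurj x
    exact ⟨c.ι.app j y, hfac j y⟩

/-- Evaluation at `x : N`, as a map `H^n(Hom(N, K)) → H^n(K)`. -/
noncomputable def homCohomologyEval (K : CochainComplex (ModuleCat.{u} R) ℕ)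
    {N : ModuleCat.{u} R} (x : N) (n : ℕ) : HomCohomology R K N n →ₗ[R] K.homology n :=
  LinearMap.applyₗ x ∘ₗ ModuleCat.homLinearEquiv.toLinearMap ∘ₗ homCohomologyπ R K N n

namespace IdealSystem

variable (Φ : IdealSystem R) {M N N' : ModuleCat.{u} R} (I : InjectiveResolution M)
  {b b' : Ideal R}

/-- `Ext^n(N, M)` is the `n`-th cohomology of `Hom(N, Γ_Φ(I))` if `I` is an injective resolution
of `M` and `N` is annihilated by a member of `Φ`. -/
noncomputable def homCohomologyTorsionEquivExt (hb : b ∈ Φ) (hN : b ≤ Module.annihilator R N)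
    (n : ℕ) : HomCohomology R (Φ.torsionComplex I.cocomplex) N n ≃ₗ[R]
      ((Ext R (ModuleCat.{u} R) n).obj (.op N)).obj M :=
  Φ.homCohomologyTorsionEquiv I.cocomplex hb hN n ≪≫ₗ homCohomologyEquivExt R I N n ≪≫ₗ
    extComparison R (projectiveResolution N) M n

lemma homCohomologyTorsionEquivExt_comp (hb : b ∈ Φ) (hN : b ≤ Module.annihilator R N)
    (hb' : b' ∈ Φ) (hN' : b' ≤ Module.annihilator R N') (n : ℕ) (g : N' ⟶ N)
    (f : N ⟶ (Φ.torsionComplex I.cocomplex).cycles n) :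
    Φ.homCohomologyTorsionEquivExt I hb' hN' n (Submodule.Quotient.mk (g ≫ f)) =
      ((Ext R (ModuleCat.{u} R) n).map g.op).app M
        (Φ.homCohomologyTorsionEquivExt I hb hN n (Submodule.Quotient.mk f)) := by
  refine Eq.trans (congrArg (extComparison R (projectiveResolution N') M n) ?_)
    (extComparison_comp R (projectiveResolution N) (projectiveResolution N') M n g _)
  exact (congrArg (cocycleClass R I N' n) (Category.assoc _ _ _)).trans
    (cocycleClass_comp R I N n g (f ≫ HomologicalComplex.cyclesMap (Φ.torsionComplexι _) n))

end IdealSystem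

open localCohomology in
/-- The inverse system of the modules `R ⧸ a ^ n`. -/
noncomputable abbrev powerQuotients (a : Ideal R) : ℕᵒᵖ ⥤ ModuleCat.{u} R :=
  ringModIdeals (idealPowersDiagram a)

variable (a : Ideal R) (K : CochainComplex (ModuleCat.{u} R) ℕ) (i : ℕ)

lemma pow_le_annihilator_powerQuotients (n : ℕ) :
    a ^ n ≤ Module.annihilator R ((powerQuotients a).obj (.op n)) :=
  Ideal.annihilator_quotient.ge

lemma exists_powerQuotients_hom {X : ModuleCat.{u} R} {n : ℕ} (x : X)
    (hx : ∀ r ∈ a ^ n, r • x = 0) :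
    ∃ f : (powerQuotients a).obj (.op n) ⟶ X, f (1 : R ⧸ a ^ n) = x :=
  ⟨ModuleCat.ofHom (Submodule.liftQ (a ^ n) (LinearMap.toSpanSingleton R X x) hx), one_smul R x⟩

lemma powerQuotients_hom_ext {X : ModuleCat.{u} R} {n : ℕ}
    {f g : (powerQuotients a).obj (.op n) ⟶ X} (h : f (1 : R ⧸ a ^ n) = g (1 : R ⧸ a ^ n)) :
    f = g :=
  ModuleCat.hom_ext (Submodule.linearMap_qext _ (LinearMap.ext_ring h))

lemma exists_homologyπ_apply_one_eq (x : ((IdealSystem.powers a).torsionComplex K).homology i) :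
    ∃ (n : ℕ) (f : (powerQuotients a).obj (.op n) ⟶
      ((IdealSystem.powers a).torsionComplex K).cycles i),
      ((IdealSystem.powers a).torsionComplex K).homologyπ i (f (1 : R ⧸ a ^ n)) = x := by
  obtain ⟨z, rfl⟩ := (ModuleCat.epi_iff_surjective
    (((IdealSystem.powers a).torsionComplex K).homologyπ i)).1 inferInstance x
  obtain ⟨_, ⟨n, rfl⟩, hz⟩ := (IdealSystem.powers a).exists_mem_smul_cycles_eq_zero K i z
  obtain ⟨f, rfl⟩ := exists_powerQuotients_hom a z hz
  exact ⟨n, f, rfl⟩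

lemma exists_mk_powerQuotients_map_comp_eq_zero {n : ℕ}
    (f : (powerQuotients a).obj (.op n) ⟶ ((IdealSystem.powers a).torsionComplex K).cycles i)
    (hf : ((IdealSystem.powers a).torsionComplex K).homologyπ i (f (1 : R ⧸ a ^ n)) = 0) :
    ∃ (m : ℕ) (h : n ≤ m), (Submodule.Quotient.mk ((powerQuotients a).map (homOfLE h).op ≫ f) :
      HomCohomology R ((IdealSystem.powers a).torsionComplex K) _ i) = 0 := by
  obtain ⟨w, hw⟩ := (ker_homologyπ ((IdealSystem.powers a).torsionComplex K) i).le hf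
  obtain ⟨_, ⟨m, rfl⟩, hm⟩ := w.2
  obtain ⟨g, hg⟩ := exists_powerQuotients_hom a (n := max n m) w fun r hr =>
    Subtype.ext (hm r (Ideal.pow_le_pow_right (le_max_right n m) hr))
  refine ⟨max n m, le_max_left n m, (Submodule.Quotient.mk_eq_zero _).2
    ⟨g, powerQuotients_hom_ext a ?_⟩⟩
  exact (congrArg _ hg).trans hw

variable {M : ModuleCat.{u} R} (I : InjectiveResolution M)

/-- `Ext^i(R ⧸ a ^ n, M)` as the `i`-th cohomology of `Hom(R ⧸ a ^ n, Γ_a(I))`, for `I` an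
injective resolution of `M`. -/
noncomputable def homCohomologyPowerQuotientsEquiv (n : ℕ) :
    HomCohomology R ((IdealSystem.powers a).torsionComplex I.cocomplex)
        ((powerQuotients a).obj (.op n)) i ≃ₗ[R]
      ((Ext R (ModuleCat.{u} R) i).obj (.op ((powerQuotients a).obj (.op n)))).obj M :=
  (IdealSystem.powers a).homCohomologyTorsionEquivExt I (IdealSystem.pow_mem_powers a n)
    (pow_le_annihilator_powerQuotients a n) i

/-- The direct system of the modules `Ext^i(R ⧸ a ^ n, M)`. -/
noncomputable abbrev extPowerQuotients (M : ModuleCat.{u} R) : ℕᵒᵖᵒᵖ ⥤ ModuleCat.{u} R :=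
  localCohomology.diagram (localCohomology.idealPowersDiagram a) i ⋙ (evaluation _ _).obj M

lemma homCohomologyPowerQuotientsEquiv_map_comp {m n : ℕ} (h : n ≤ m)
    (f : (powerQuotients a).obj (.op n) ⟶
      ((IdealSystem.powers a).torsionComplex I.cocomplex).cycles i) :
    homCohomologyPowerQuotientsEquiv a i I m
        (Submodule.Quotient.mk ((powerQuotients a).map (homOfLE h).op ≫ f)) =
      (extPowerQuotients a i M).map (homOfLE h).op.op
        (homCohomologyPowerQuotientsEquiv a i I n (Submodule.Quotient.mk f)) :=
  IdealSystem.homCohomologyTorsionEquivExt_comp _ _ _ _ _ _ _ _ _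

/-- The map `Ext^i(R ⧸ a ^ n, M) → H^i(Γ_a(I))` given by evaluation at `1` of maps from `R ⧸ a ^ n`
to `Γ_a(I)`. -/
noncomputable def extPowerQuotientsEval (n : ℕ) :
    (extPowerQuotients a i M).obj (.op (.op n)) →ₗ[R]
      ((IdealSystem.powers a).torsionComplex I.cocomplex).homology i :=
  homCohomologyEval _ (N := (powerQuotients a).obj (.op n)) (1 : R ⧸ a ^ n) i ∘ₗ
    (homCohomologyPowerQuotientsEquiv a i I n).symm.toLinearMap

lemma extPowerQuotientsEval_mk {n : ℕ} (f : (powerQuotients a).obj (.op n) ⟶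
      ((IdealSystem.powers a).torsionComplex I.cocomplex).cycles i) :
    extPowerQuotientsEval a i I n
        (homCohomologyPowerQuotientsEquiv a i I n (Submodule.Quotient.mk f)) =
      ((IdealSystem.powers a).torsionComplex I.cocomplex).homologyπ i (f (1 : R ⧸ a ^ n)) :=
  congrArg (homCohomologyEval _ (N := (powerQuotients a).obj (.op n)) (1 : R ⧸ a ^ n) i)
    (LinearEquiv.symm_apply_apply _ _)

lemma exists_homCohomologyPowerQuotientsEquiv_mk_eq {n : ℕ}
    (x : (extPowerQuotients a i M).obj (.op (.op n))) :
    ∃ f, homCohomologyPowerQuotientsEquiv a i I n (Submodule.Quotient.mk f) = x := by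
  obtain ⟨y, rfl⟩ := (homCohomologyPowerQuotientsEquiv a i I n).surjective x
  obtain ⟨f, rfl⟩ := Submodule.Quotient.mk_surjective _ y
  exact ⟨f, rfl⟩

lemma extPowerQuotientsEval_map {m n : ℕ} (h : n ≤ m)
    (x : (extPowerQuotients a i M).obj (.op (.op n))) :
    extPowerQuotientsEval a i I m ((extPowerQuotients a i M).map (homOfLE h).op.op x) =
      extPowerQuotientsEval a i I n x := by
  obtain ⟨f, rfl⟩ := exists_homCohomologyPowerQuotientsEquiv_mk_eq a i I x
  rw [← homCohomologyPowerQuotientsEquiv_map_comp, extPowerQuotientsEval_mk,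
    extPowerQuotientsEval_mk]
  rfl

/-- The maps `Ext^i(R ⧸ a ^ n, M) → H^i(Γ_a(I))` form a cocone over the direct system. -/
noncomputable def extPowerQuotientsCocone : Limits.Cocone (extPowerQuotients a i M) where
  pt := ((IdealSystem.powers a).torsionComplex I.cocomplex).homology i
  ι :=
    { app n := ModuleCat.ofHom (extPowerQuotientsEval a i I n.unop.unop)
      naturality _ _ h := ModuleCat.hom_ext (LinearMap.ext fun x =>
        extPowerQuotientsEval_map a i I (leOfHom h.unop.unop) x) }

instance : Limits.HasColimit
    (localCohomology.diagram (localCohomology.idealPowersDiagram a) i) :=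
  localCohomology.hasColimitDiagram.{u, 0} _ i

instance : Limits.PreservesFilteredColimitsOfSize.{0, 0} (forget (ModuleCat.{u} R)) :=
  Limits.preservesFilteredColimitsOfSize_shrink.{0, u, 0, u} _

/-- The local cohomology of `M` with respect to `a`, defined as a direct limit of `Ext` modules, as
the cohomology of `Γ_a(I)`, for `I` an injective resolution of `M`. -/
noncomputable def localCohomologyEquiv :
    (localCohomology a i).obj M ≃ₗ[R]
      ((IdealSystem.powers a).torsionComplex I.cocomplex).homology i :=
  LinearEquiv.ofBijective ((Limits.isColimitOfPreserves ((evaluation _ _).obj M)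
      (Limits.colimit.isColimit (localCohomology.diagram
        (localCohomology.idealPowersDiagram a) i))).desc (extPowerQuotientsCocone a i I)).hom <| by
    refine bijective_desc _ _ (fun x => ?_) fun n y hy => ?_
    · obtain ⟨n, f, hf⟩ := exists_homologyπ_apply_one_eq a I.cocomplex i x
      exact ⟨.op (.op n), _, (extPowerQuotientsEval_mk a i I f).trans hf⟩
    · obtain ⟨f, rfl⟩ := exists_homCohomologyPowerQuotientsEquiv_mk_eq a i I y
      obtain ⟨m, h, hm⟩ := exists_mk_powerQuotients_map_comp_eq_zero a I.cocomplex i f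
        ((extPowerQuotientsEval_mk a i I f).symm.trans hy)
      exact ⟨.op (.op m), (homOfLE h).op.op,
        (homCohomologyPowerQuotientsEquiv_map_comp a i I h f).symm.trans
          ((congrArg _ hm).trans (map_zero _))⟩

end LocalCohomology

lemma exists_pow_le_annihilator {R : Type*} [CommRing R] {a : Ideal R} (ha : a.FG) (N : Type*)
    [AddCommGroup N] [Module R N] [Module.Finite R N]
    (h : Module.support R N ⊆ PrimeSpectrum.zeroLocus a) :
    ∃ k : ℕ, a ^ k ≤ Module.annihilator R N := by
  refine Ideal.exists_pow_le_of_le_radical_of_fg ?_ ha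
  rwa [← PrimeSpectrum.zeroLocus_subset_zeroLocus_iff, ← Module.support_eq_zeroLocus]

section Main

variable {R : Type u} [CommRing R] [IsNoetherianRing R]
  (S : ObjectProperty (ModuleCat.{u} R)) [S.IsSerreClass]

lemma IdealSystem.prop_homCohomology_of_prop_ext (Φ : IdealSystem R) {N M : ModuleCat.{u} R}
    (I : InjectiveResolution M) {b : Ideal R} (hb : b ∈ Φ) (hN : b ≤ Module.annihilator R N)
    (n : ℕ) (h : ∀ p q, p + q = n →
      S (ModuleCat.of R (Abelian.Ext N ((Φ.localCohomology p).obj M) q))) :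
    S (ModuleCat.of R (HomCohomology R I.cocomplex N n)) := by
  have (p : ℕ) : Injective ((Φ.torsionComplex I.cocomplex).X p) :=
    Φ.injective_torsionFunctor_obj (I.cocomplex.X p)
  let e := Φ.homCohomologyTorsionEquiv I.cocomplex hb hN n
  refine prop_of_surjective S e.toLinearMap e.surjective
    (prop_homCohomology S (Φ.torsionComplex I.cocomplex) N n fun p q hpq => ?_)
  exact prop_ext_of_iso S N (I.isoRightDerivedObj Φ.torsionFunctor p) q (h p q hpq)

variable {S} in
theorem IsMelkersson.prop_localCohomology {a : Ideal R} (hSa : IsMelkersson S a)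
    {Φ : IdealSystem R} (ha : a ∈ Φ) (M N : ModuleCat.{u} R) [Module.Finite R N]
    (hN : Module.support R N = PrimeSpectrum.zeroLocus (a : Set R)) (i : ℕ)
    (h : ∀ p q, p + q ≤ i →
      S (ModuleCat.of R (Abelian.Ext N ((Φ.localCohomology p).obj M) q))) :
    S ((localCohomology a i).obj M) := by
  let I := injectiveResolution M
  obtain ⟨k, hk⟩ := exists_pow_le_annihilator (IsNoetherian.noetherian a) N hN.le
  obtain ⟨b, hb, hbk⟩ := Φ.exists_le_pow ha k
  have hHom : ∀ j ≤ i, S (ModuleCat.of R (HomCohomology R I.cocomplex N j)) := fun j hj =>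
    Φ.prop_homCohomology_of_prop_ext S I hb (hbk.trans hk) j fun p q hpq =>
      h p q (hpq.le.trans hj)
  let e := localCohomologyEquiv a i I
  exact prop_of_injective S e.toLinearMap e.injective
    (hSa.prop_homology_torsionComplex_of_homCohomology I.cocomplex N hN.ge hk i hHom)

end Main

theorem corollary2p6 {R : Type u} [CommRing R] [IsNoetherianRing R] (Φ : IdealSystem R)
    (S : ObjectProperty (ModuleCat.{u} R)) [S.IsSerreClass]
    (hS : ∀ a ∈ Φ, IsMelkersson S a) (M : ModuleCat.{u} R) (t : ℕ) :
    (∀ a ∈ Φ, ∀ N : ModuleCat.{u} R, Module.Finite R N →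
      Module.support R N = PrimeSpectrum.zeroLocus (a : Set R) →
      (∀ i < t, ∀ j < t - i,
        S (ModuleCat.of R (Abelian.Ext N ((Φ.localCohomology i).obj M) j))) →
      ∀ i < t, S ((localCohomology a i).obj M)) ∧
    ((∀ i < t, S ((Φ.localCohomology i).obj M)) →
      ∀ a ∈ Φ, ∀ i < t, S ((localCohomology a i).obj M)) := by
  refine ⟨fun a ha N _ hN h i hi => ?_, fun h a ha i hi => ?_⟩
  · exact (hS a ha).prop_localCohomology ha M N hN i fun p q hpq =>
      h p (by omega) q (by omega)
  · have hsupp : Module.support R (R ⧸ a) = PrimeSpectrum.zeroLocus (a : Set R) := by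
      rw [Module.support_eq_zeroLocus, Ideal.annihilator_quotient]
    exact (hS a ha).prop_localCohomology ha M (ModuleCat.of R (R ⧸ a)) hsupp i fun p q hpq =>
      prop_ext_of_finite S (ModuleCat.of R (R ⧸ a)) _ (h p (by omega)) q
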